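/- **Setting.** Let $E$ be a complex Banach space, $A$ a commutative unital complex Banach algebra with unit $\mathbf 1$, and $K\subset E$ a compact set. For a commutative unital Banach algebra $B$ let $\mathbb P(E,B)$ be the space of all polynomials $P=P_0+P_1+\dots+P_n:E\to B$ where $P_0$ is constant and, for $k\ge 1$, $P_k(x)=\sum_{i=1}^\infty T_i(x)^k$ with bounded linear operators $T_i:E\to B$ satisfying $\sum_i\|T_i\|^k<\infty$. Let $\mathbb P(K,B)$ be the closure in $C(K,B)$ (uniform norm) of the restrictions $P|_K$, $P\in\mathbb P(E,B)$; it is a closed subalgebra of $C(K,B)$. Put $\mathcal P_N(E)=\mathbb P(E,\mathbb C)$ (nuclear polynomials), $\mathcal P_N(K)=\mathbb P(K,\mathbb C)$, and $$\hat K_N=\{a\in E: |P(a)|\le \sup_{x\in K}|P(x)| \text{ for all } P\in\mathcal P_N(E)\},$$ with the norm topology of $E$. $\mathfrak M(\cdot)$ denotes the character space with the Gelfand topology. For a Banach space $F$, the injective tensor product $\mathcal P_N(K)\hat\otimes_\varepsilon F$ is regarded as a subspace of $C(K,F)$ through the isometric embedding determined by $f\otimes y\mapsto (x\mapsto f(x)y)$.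 **Theorem.** There is a map $j:\hat K_N\times\mathfrak M(A)\to\mathfrak M(\mathbb P(K,A))$ with $$j(a,\varphi)(P|_K)=\varphi(P(a))\qquad (a\in\hat K_N,\ \varphi\in\mathfrak M(A),\ P\in\mathbb P(E,A)),$$ and $j$ is a homeomorphism onto a closed subset of $\mathfrak M(\mathbb P(K,A))$. If $\mathbb P(K,A)=\mathcal P_N(K)\hat\otimes_\varepsilon A$, then $j$ is a homeomorphism of $\hat K_N\times\mathfrak M(A)$ onto $\mathfrak M(\mathbb P(K,A))$. Moreover, each of the following conditions implies that $\mathbb P(K,A)=\mathcal P_N(K)\hat\otimes_\varepsilon A$, and hence that $j$ is a homeomorphism onto $\mathfrak M(\mathbb P(K,A))$: 1. $\mathbb P(K,B)=\mathcal P_N(K)\hat\otimes_\varepsilon B$ for some commutative unital Banach algebra $B$ that is linearly homeomorphic to $E$ (for example $E$ itself, with an equivalent norm and a product making it a commutative unital Banach algebra); 2. the identity operator $I:E\to E$, restricted to $K$, belongs to $\mathcal P_N(K)\hat\otimes_\varepsilon E$; 3. $E$ has the approximation property; 4. $A$ has the approximation property and the linear span of $\mathfrak M(A)$ is dense in $A^*$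 for the topology of uniform convergence on compact subsets of $A$. Here a Banach space $X$ has the approximation property if for every $\varepsilon>0$ and every compact $C\subset X$ there is a bounded finite rank operator $T:X\to X$ with $\|T(x)-x\|<\varepsilon$ for all $x\in C$. -/

import Mathlib

open scoped TensorProduct CompactConvergenceCLM

universe u v

noncomputable section

namespace GenPoly

/-! ### Polynomials generated by bounded linear operators -/

section Polynomials

variable {E : Type u} [NormedAddCommGroup E] [NormedSpace ℂ E]
variable {A : Type v} [NormedCommRing A] [NormedAlgebra ℂ A]

/-- `P : E → A` is an `n`-homogeneous polynomial generated by bounded linear operators: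
a constant map if `n = 0`, and otherwise a map `P(x) = ∑ᵢ Tᵢ(x)ⁿ` with `Tᵢ : E → A` bounded
linear operators such that `∑ᵢ ‖Tᵢ‖ⁿ < ∞`. -/
def IsHomogeneousGen (n : ℕ) (P : E → A) : Prop :=
  (n = 0 ∧ ∃ c : A, ∀ x, P x = c) ∨
  (n ≠ 0 ∧ ∃ T : ℕ → E →L[ℂ] A, Summable (fun i => ‖T i‖ ^ n) ∧
    ∀ x, HasSum (fun i => T i x ^ n) (P x))

variable (E A) in
/-- The space `ℙ(E, A)` of all polynomials `P = P₀ + P₁ + ⋯ + Pₙ` where each `Pₖ` is a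
`k`-homogeneous polynomial generated by bounded linear operators. For `A = ℂ` this is the
space `𝒫_N(E)` of nuclear polynomials. -/
def polySpace : Set (E → A) :=
  {P | ∃ (n : ℕ) (Q : ℕ → E → A), (∀ k ≤ n, IsHomogeneousGen k (Q k)) ∧
    ∀ x, P x = ∑ k ∈ Finset.range (n + 1), Q k x}

/-- The set `ℙ₀(K, A)` of restrictions to `K` of the polynomials in `ℙ(E, A)`. -/
def polyRestr (K : TopologicalSpace.Compacts E) (A : Type v) [NormedCommRing A]
    [NormedAlgebra ℂ A] : Set C(K, A) :=
  {f | ∃ P ∈ polySpace E A, ∀ x : K, f x = P x}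

/-- The nuclear polynomially convex hull `K̂_N = {a : |P(a)| ≤ ‖P‖_K for all P ∈ 𝒫_N(E)}`. -/
def nuclearHull (K : TopologicalSpace.Compacts E) : Set E :=
  {a | ∀ P ∈ polySpace E ℂ, ‖P a‖ ≤ ⨆ x : K, ‖P x‖}

/-! ### The closure of the restrictions is an algebra -/

theorem coeff_mem {M : Type*} [AddCommGroup M] [Module ℂ M] (W : Submodule ℂ M) (n : ℕ)
    (c : Fin (n + 1) → M) (h : ∀ z : ℂ, ∑ k : Fin (n + 1), z ^ (k : ℕ) • c k ∈ W) (k : Fin (n + 1)) :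
    c k ∈ W := by
  set V : Matrix (Fin (n + 1)) (Fin (n + 1)) ℂ :=
    Matrix.vandermonde (fun i => ((i : ℕ) : ℂ)) with hV
  have hdet : IsUnit V.det := by
    rw [isUnit_iff_ne_zero, hV, Matrix.det_vandermonde_ne_zero_iff]
    intro i j hij
    exact Fin.ext (Nat.cast_injective hij)
  have hmul : V⁻¹ * V = 1 := Matrix.nonsing_inv_mul V hdet
  have key : c k = ∑ j, V⁻¹ k j • ∑ i : Fin (n + 1), (((j : ℕ) : ℂ)) ^ (i : ℕ) • c i := by
    have h1 : ∀ i : Fin (n + 1), ∑ j, V⁻¹ k j * (((j : ℕ) : ℂ)) ^ (i : ℕ) =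
        (1 : Matrix (Fin (n + 1)) (Fin (n + 1)) ℂ) k i := by
      intro i
      rw [← hmul, Matrix.mul_apply]
      rfl
    simp_rw [Finset.smul_sum, smul_smul]
    rw [Finset.sum_comm]
    simp_rw [← Finset.sum_smul, h1, Matrix.one_apply]
    simp
  rw [key]
  exact W.sum_mem fun j _ => W.smul_mem _ (h _)

theorem polarization {R : Type*} [CommRing R] [Algebra ℂ R] (W : Submodule ℂ R) (f g : R)
    (N : ℕ) (h : ∀ z : ℂ, (z • f + g) ^ N ∈ W) (k : ℕ) (hk : k ≤ N) :
    f ^ k * g ^ (N - k) ∈ W := by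
  have h2 := coeff_mem W N (fun i => (N.choose i : ℂ) • (f ^ (i : ℕ) * g ^ (N - i))) (by
    intro z
    have := h z
    rw [add_pow, Finset.sum_range] at this
    convert this using 2 with i
    rw [smul_pow, smul_mul_assoc, smul_mul_assoc]
    congr 1
    rw [Algebra.smul_def, mul_comm]
    simp) ⟨k, by omega⟩
  have hne : (N.choose k : ℂ) ≠ 0 := by
    exact_mod_cast (Nat.choose_pos hk).ne'
  simpa [smul_smul, hne] using W.smul_mem ((N.choose k : ℂ)⁻¹) h2

theorem isHomogeneousGen_zero (n : ℕ) : IsHomogeneousGen n (0 : E → A) := by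
  by_cases hn : n = 0
  · exact Or.inl ⟨hn, 0, fun _ => rfl⟩
  · exact Or.inr ⟨hn, fun _ => 0, by simp [hn, summable_zero], fun x => by
      simp [hn]⟩

theorem IsHomogeneousGen.add {n : ℕ} {P Q : E → A} (hP : IsHomogeneousGen n P)
    (hQ : IsHomogeneousGen n Q) : IsHomogeneousGen n (P + Q) := by
  rcases hP with ⟨hn, c, hc⟩ | ⟨hn, S, hS, hPS⟩
  · rcases hQ with ⟨_, d, hd⟩ | ⟨hn', _⟩
    · exact Or.inl ⟨hn, c + d, fun x => by simp [hc, hd]⟩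
    · exact absurd hn hn'
  · rcases hQ with ⟨hn', _⟩ | ⟨_, T, hT, hQT⟩
    · exact absurd hn' hn
    · refine Or.inr ⟨hn, fun i => Sum.elim S T (Equiv.natSumNatEquivNat.symm i), ?_, fun x => ?_⟩
      · have : Summable (fun i : ℕ ⊕ ℕ => ‖Sum.elim S T i‖ ^ n) :=
          (HasSum.sum (f := fun i : ℕ ⊕ ℕ => ‖Sum.elim S T i‖ ^ n) hS.hasSum hT.hasSum).summable
        exact (Equiv.natSumNatEquivNat.symm.summable_iff
          (f := fun i : ℕ ⊕ ℕ => ‖Sum.elim S T i‖ ^ n)).2 this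
      · have : HasSum (fun i : ℕ ⊕ ℕ => (Sum.elim S T i) x ^ n) (P x + Q x) :=
          HasSum.sum (f := fun i : ℕ ⊕ ℕ => (Sum.elim S T i) x ^ n) (hPS x) (hQT x)
        exact (Equiv.natSumNatEquivNat.symm.hasSum_iff
          (f := fun i : ℕ ⊕ ℕ => (Sum.elim S T i) x ^ n)).2 this

theorem IsHomogeneousGen.smul {n : ℕ} {P : E → A} (hP : IsHomogeneousGen n P) (z : ℂ) :
    IsHomogeneousGen n (z • P) := by
  rcases hP with ⟨hn, c, hc⟩ | ⟨hn, S, hS, hPS⟩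
  · exact Or.inl ⟨hn, z • c, fun x => by simp [hc]⟩
  · obtain ⟨w, hw⟩ := IsAlgClosed.exists_pow_nat_eq z (Nat.pos_of_ne_zero hn)
    refine Or.inr ⟨hn, fun i => w • S i, ?_, fun x => ?_⟩
    · simp_rw [norm_smul, mul_pow]
      exact hS.mul_left _
    · simpa [smul_pow, hw] using (hPS x).const_smul z

theorem polySpace_add {P Q : E → A} (hP : P ∈ polySpace E A) (hQ : Q ∈ polySpace E A) :
    P + Q ∈ polySpace E A := by
  obtain ⟨m, S, hS, hPS⟩ := hP
  obtain ⟨n, T, hT, hQT⟩ := hQ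
  refine ⟨max m n, fun k => (if k ≤ m then S k else 0) + (if k ≤ n then T k else 0),
    fun k _ => ?_, fun x => ?_⟩
  · refine IsHomogeneousGen.add ?_ ?_
    · split_ifs with h
      exacts [hS k h, isHomogeneousGen_zero k]
    · split_ifs with h
      exacts [hT k h, isHomogeneousGen_zero k]
  · have aux : ∀ (p q : ℕ) (U : ℕ → E → A), p ≤ q →
        ∑ k ∈ Finset.range (q + 1), (if k ≤ p then U k else 0) x =
          ∑ k ∈ Finset.range (p + 1), U k x := by
      intro p q U hpq
      rw [← Finset.sum_subset (Finset.range_subset_range.2 (Nat.succ_le_succ hpq))]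
      · refine Finset.sum_congr rfl fun k hk => ?_
        rw [if_pos (Nat.lt_succ_iff.1 (Finset.mem_range.1 hk))]
      · intro k _ hk
        rw [if_neg (fun h => hk (Finset.mem_range.2 (Nat.lt_succ_of_le h)))]
        rfl
    simp only [Pi.add_apply, Finset.sum_add_distrib]
    rw [aux m _ S (le_max_left _ _), aux n _ T (le_max_right _ _), hPS, hQT]

theorem polySpace_smul {P : E → A} (hP : P ∈ polySpace E A) (z : ℂ) :
    z • P ∈ polySpace E A := by
  obtain ⟨m, S, hS, hPS⟩ := hP
  exact ⟨m, fun k => z • S k, fun k hk => (hS k hk).smul z, fun x => by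
    simp [hPS, Finset.smul_sum]⟩

theorem IsHomogeneousGen.mem_polySpace {n : ℕ} {P : E → A} (hP : IsHomogeneousGen n P) :
    P ∈ polySpace E A := by
  refine ⟨n, fun k => if k = n then P else 0, fun k _ => ?_, fun x => ?_⟩
  · dsimp only
    split_ifs with h
    exacts [h ▸ hP, isHomogeneousGen_zero k]
  · rw [Finset.sum_eq_single n]
    · simp
    · intro k _ hk
      simp [hk]
    · simp

/-- The restriction to `K` of a bounded linear operator, as a continuous function. -/
def restrCLM (K : TopologicalSpace.Compacts E) (T : E →L[ℂ] A) : C(K, A) :=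
  ⟨fun x => T x, T.continuous.comp continuous_subtype_val⟩

/-- Constants and powers of bounded linear operators, restricted to `K`. -/
def genSet (K : TopologicalSpace.Compacts E) (A : Type v) [NormedCommRing A]
    [NormedAlgebra ℂ A] : Set C(K, A) :=
  {f | (∃ c : A, f = ContinuousMap.const K c) ∨
    ∃ (n : ℕ) (T : E →L[ℂ] A), n ≠ 0 ∧ f = restrCLM K T ^ n}

theorem const_mul_pow_mem (K : TopologicalSpace.Compacts E) (c : A) (n : ℕ) (hn : n ≠ 0)
    (T : E →L[ℂ] A) :
    ContinuousMap.const K c * restrCLM K T ^ n ∈ Submodule.span ℂ (genSet K A) := by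
  have := polarization
    ((Submodule.span ℂ (genSet K A)).comap
      ((LinearMap.mul ℂ C(K, A)).flip (restrCLM K T ^ n)))
    (ContinuousMap.const K c) 1 n (by
      intro z
      refine Submodule.subset_span (Or.inr ⟨n, ((ContinuousLinearMap.mul ℂ A) (z • c + 1)).comp T,
        hn, ?_⟩)
      simp only [LinearMap.flip_apply, LinearMap.mul_apply', ← mul_pow]
      congr 1) 1 (Nat.one_le_iff_ne_zero.2 hn)
  simpa [mul_comm] using this

theorem genSet_mul_mem (K : TopologicalSpace.Compacts E) {f g : C(K, A)} (hf : f ∈ genSet K A)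
    (hg : g ∈ genSet K A) : f * g ∈ Submodule.span ℂ (genSet K A) := by
  rcases hf with ⟨c, rfl⟩ | ⟨m, S, hm, rfl⟩
  · rcases hg with ⟨d, rfl⟩ | ⟨n, T, hn, rfl⟩
    · exact Submodule.subset_span (Or.inl ⟨c * d, rfl⟩)
    · exact const_mul_pow_mem K c n hn T
  · rcases hg with ⟨d, rfl⟩ | ⟨n, T, hn, rfl⟩
    · rw [mul_comm]
      exact const_mul_pow_mem K d m hm S
    · have := polarization (Submodule.span ℂ (genSet K A)) (restrCLM K S) (restrCLM K T) (m + n)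
        (fun z => Submodule.subset_span (Or.inr ⟨m + n, z • S + T, by omega, by
          congr 1⟩)) m (by omega)
      simpa using this

/-- The algebra of finite sums of constants and powers of operators, restricted to `K`. -/
def genAlg (K : TopologicalSpace.Compacts E) (A : Type v) [NormedCommRing A]
    [NormedAlgebra ℂ A] : Subalgebra ℂ C(K, A) :=
  (Submodule.span ℂ (genSet K A)).toSubalgebra
    (Submodule.subset_span (Or.inl ⟨1, rfl⟩)) (by
      intro f g hf hg
      have h := Submodule.mul_mem_mul hf hg
      rw [Submodule.span_mul_span] at h
      refine Submodule.span_le.2 ?_ h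
      rintro _ ⟨a, ha, b, hb, rfl⟩
      exact genSet_mul_mem K ha hb)

theorem genAlg_subset (K : TopologicalSpace.Compacts E) :
    (genAlg K A : Set C(K, A)) ⊆ polyRestr K A := by
  intro f hf
  change f ∈ Submodule.span ℂ (genSet K A) at hf
  induction hf using Submodule.span_induction with
  | mem f hf =>
    rcases hf with ⟨c, rfl⟩ | ⟨n, T, hn, rfl⟩
    · exact ⟨fun _ => c, IsHomogeneousGen.mem_polySpace (n := 0) (Or.inl ⟨rfl, c, fun _ => rfl⟩),
        fun _ => rfl⟩
    · refine ⟨fun x => T x ^ n, IsHomogeneousGen.mem_polySpace (n := n) (Or.inr ⟨hn,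
        fun i => if i = 0 then T else 0, ?_, fun x => ?_⟩), fun _ => rfl⟩
      · refine summable_of_ne_finset_zero (s := {0}) fun i hi => ?_
        simp only [Finset.mem_singleton] at hi
        simp [hi, hn]
      · have := hasSum_single (f := fun i : ℕ => (if i = 0 then T else 0) x ^ n) 0
          (fun i hi => by simp [hi, hn])
        simpa using this
  | zero => exact ⟨0, (isHomogeneousGen_zero 0).mem_polySpace, fun _ => rfl⟩
  | add f g _ _ hf hg =>
    obtain ⟨P, hP, hfP⟩ := hf
    obtain ⟨Q, hQ, hgQ⟩ := hg
    exact ⟨P + Q, polySpace_add hP hQ, fun x => by simp [hfP, hgQ]⟩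
  | smul z f _ hf =>
    obtain ⟨P, hP, hfP⟩ := hf
    exact ⟨z • P, polySpace_smul hP z, fun x => by simp [hfP]⟩

theorem polyRestr_subset (K : TopologicalSpace.Compacts E) [CompleteSpace A] :
    polyRestr K A ⊆ closure (genAlg K A : Set C(K, A)) := by
  have key : ∀ (n : ℕ) (P : E → A), IsHomogeneousGen n P →
      ∃ h ∈ (genAlg K A).topologicalClosure, ∀ x : K, h x = P x := by
    intro n P hP
    rcases hP with ⟨_, c, hc⟩ | ⟨hn, T, hT, hPT⟩
    · exact ⟨ContinuousMap.const K c, subset_closure (Submodule.subset_span (Or.inl ⟨c, rfl⟩)),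
        fun x => by simp [hc]⟩
    · obtain ⟨M, hM⟩ := K.isCompact.isBounded.exists_norm_le
      have hM0 : ∀ x : K, ‖(x : E)‖ ≤ max M 0 := fun x => (hM x x.2).trans (le_max_left _ _)
      have hle : ∀ i, ‖restrCLM K (T i) ^ n‖ ≤ (max M 0) ^ n * ‖T i‖ ^ n := by
        intro i
        rw [ContinuousMap.norm_le _ (by positivity)]
        intro x
        calc ‖(restrCLM K (T i) ^ n) x‖ = ‖T i x ^ n‖ := rfl
          _ ≤ ‖T i x‖ ^ n := norm_pow_le' _ (Nat.pos_of_ne_zero hn)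
          _ ≤ (‖T i‖ * max M 0) ^ n := by
            gcongr
            exact (T i).le_opNorm_of_le (hM0 x)
          _ = _ := by ring
      have hsum : Summable (fun i => restrCLM K (T i) ^ n) :=
        Summable.of_norm_bounded (hT.mul_left _) hle
      refine ⟨∑' i, restrCLM K (T i) ^ n, ?_, fun x => ?_⟩
      · refine isClosed_closure.mem_of_tendsto hsum.hasSum (Filter.Eventually.of_forall fun s => ?_)
        exact subset_closure ((Submodule.span ℂ (genSet K A)).sum_mem fun i _ =>
          Submodule.subset_span (Or.inr ⟨n, T i, hn, rfl⟩))
      · have h1 := ContinuousMap.hasSum_apply hsum.hasSum x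
        exact h1.unique (hPT x)
  rintro f ⟨P, ⟨n, Q, hQ, hPQ⟩, hf⟩
  choose! h hmem hval using fun k (hk : k ≤ n) => key k (Q k) (hQ k hk)
  have hfh : f = ∑ k ∈ Finset.range (n + 1), h k := by
    ext x
    rw [hf, hPQ, ContinuousMap.coe_sum, Finset.sum_apply]
    exact Finset.sum_congr rfl fun k hk =>
      (hval k (Nat.lt_succ_iff.1 (Finset.mem_range.1 hk)) x).symm
  rw [hfh]
  exact (genAlg K A).topologicalClosure.sum_mem fun k hk =>
    hmem k (Nat.lt_succ_iff.1 (Finset.mem_range.1 hk))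

theorem closure_polyRestr (K : TopologicalSpace.Compacts E) [CompleteSpace A] :
    closure (polyRestr K A) = closure (genAlg K A : Set C(K, A)) :=
  (closure_minimal (polyRestr_subset K) isClosed_closure).antisymm
    (closure_mono (genAlg_subset K))

/-- The algebra `ℙ(K, A)`: the uniform closure in `C(K, A)` of the restrictions to `K` of the
polynomials in `ℙ(E, A)`. -/
def polyAlgebra (K : TopologicalSpace.Compacts E) (A : Type v) [NormedCommRing A]
    [NormedAlgebra ℂ A] [CompleteSpace A] : Subalgebra ℂ C(K, A) :=
  (genAlg K A).topologicalClosure.copy (closure (polyRestr K A)) (closure_polyRestr K)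

/-- The uniform algebra `𝒫_N(K)` generated by the nuclear scalar-valued polynomials. -/
abbrev nuclearAlgebra (K : TopologicalSpace.Compacts E) : Subalgebra ℂ C(K, ℂ) :=
  polyAlgebra K ℂ

end Polynomials

/-! ### The injective tensor product -/

section Injective

variable (X Y : Type*) [NormedAddCommGroup X] [NormedSpace ℂ X]
  [NormedAddCommGroup Y] [NormedSpace ℂ Y]

/-- Pairs of functionals in the closed unit balls of `X*` and `Y*`. -/
def dualBallPairs : Set ((X →L[ℂ] ℂ) × (Y →L[ℂ] ℂ)) :=
  {p | ‖p.1‖ ≤ 1 ∧ ‖p.2‖ ≤ 1}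

instance : Nonempty (dualBallPairs X Y) := ⟨⟨0, by simp [dualBallPairs]⟩⟩

variable {X Y} in
/-- The functional `ψ ⊗ φ` on the algebraic tensor product, `x ⊗ y ↦ ψ(x) φ(y)`. -/
def evalPair (p : (X →L[ℂ] ℂ) × (Y →L[ℂ] ℂ)) : X ⊗[ℂ] Y →ₗ[ℂ] ℂ :=
  LinearMap.mul' ℂ ℂ ∘ₗ TensorProduct.map (p.1 : X →ₗ[ℂ] ℂ) (p.2 : Y →ₗ[ℂ] ℂ)

variable {X Y} in
theorem evalPair_bdd (t : X ⊗[ℂ] Y) :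
    BddAbove (Set.range fun p : dualBallPairs X Y => ‖evalPair p.1 t‖) := by
  suffices h : ∃ C, ∀ p : dualBallPairs X Y, ‖evalPair p.1 t‖ ≤ C by
    obtain ⟨C, hC⟩ := h
    exact ⟨C, by rintro _ ⟨p, rfl⟩; exact hC p⟩
  induction t using TensorProduct.induction_on with
  | zero => exact ⟨0, by simp⟩
  | tmul x y =>
    refine ⟨‖x‖ * ‖y‖, fun p => ?_⟩
    simp only [evalPair, LinearMap.comp_apply, TensorProduct.map_tmul, LinearMap.mul'_apply,
      norm_mul]
    gcongr
    · simpa using p.1.1.le_of_opNorm_le p.2.1 x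
    · simpa using p.1.2.le_of_opNorm_le p.2.2 y
  | add s t hs ht =>
    obtain ⟨C, hC⟩ := hs
    obtain ⟨D, hD⟩ := ht
    exact ⟨C + D, fun p => by
      rw [map_add]
      exact norm_add_le_of_le (hC p) (hD p)⟩

/-- The injective norm `‖t‖_ε = sup {|(ψ ⊗ φ)(t)| : ‖ψ‖ ≤ 1, ‖φ‖ ≤ 1}` on `X ⊗ Y`. -/
def injSeminorm : Seminorm ℂ (X ⊗[ℂ] Y) :=
  Seminorm.of (fun t => ⨆ p : dualBallPairs X Y, ‖evalPair p.1 t‖)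
    (fun s t => ciSup_le fun p => by
      rw [map_add]
      exact norm_add_le_of_le (le_ciSup (evalPair_bdd s) p) (le_ciSup (evalPair_bdd t) p))
    (fun z t => by
      simp_rw [map_smul, norm_smul]
      exact (Real.mul_iSup_of_nonneg (norm_nonneg z) _).symm)

/-- The algebraic tensor product `X ⊗ Y` equipped with the injective norm. -/
def InjTensor : Type _ := X ⊗[ℂ] Y

instance : SeminormedAddCommGroup (InjTensor X Y) :=
  (injSeminorm X Y).toAddGroupSeminorm.toSeminormedAddCommGroup

instance : Module ℂ (InjTensor X Y) := inferInstanceAs (Module ℂ (X ⊗[ℂ] Y))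

instance : NormedSpace ℂ (InjTensor X Y) where
  norm_smul_le z t := (map_smul_eq_mul (injSeminorm X Y) z t).le

/-- The injective tensor product `X ⊗̂_ε Y`: the completion of `X ⊗ Y` in the injective norm. -/
abbrev CompletedInjTensor : Type _ := UniformSpace.Completion (InjTensor X Y)

end Injective

section Representation

variable {E : Type u} [NormedAddCommGroup E] [NormedSpace ℂ E]

/-- The linear map `𝒫_N(K) ⊗ F → C(K, F)`, `f ⊗ a ↦ (x ↦ f(x) a)`. -/
def tensorToFunAlg (K : TopologicalSpace.Compacts E) (F : Type*) [NormedAddCommGroup F]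
    [NormedSpace ℂ F] : nuclearAlgebra K ⊗[ℂ] F →ₗ[ℂ] C(K, F) :=
  TensorProduct.lift (LinearMap.mk₂ ℂ
    (fun (f : nuclearAlgebra K) (a : F) =>
      (⟨fun x => f.1 x • a, by fun_prop⟩ : C(K, F)))
    (fun f g a => by ext x; simp [add_smul])
    (fun z f a => by ext x; simp [mul_smul])
    (fun f a b => by ext x; simp)
    (fun z f a => by ext x; simp [smul_comm z]))

theorem tensorToFunAlg_tmul (K : TopologicalSpace.Compacts E) (F : Type*)
    [NormedAddCommGroup F] [NormedSpace ℂ F] (f : nuclearAlgebra K) (a : F) (x : K) :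
    tensorToFunAlg K F (f ⊗ₜ a) x = f.1 x • a := rfl

/-- The canonical map is isometric for the injective norm. -/
theorem norm_tensorToFunAlg (K : TopologicalSpace.Compacts E) (F : Type*)
    [NormedAddCommGroup F] [NormedSpace ℂ F] (t : nuclearAlgebra K ⊗[ℂ] F) :
    ‖tensorToFunAlg K F t‖ = injSeminorm (nuclearAlgebra K) F t := by
  apply le_antisymm
  · rw [ContinuousMap.norm_le _ (apply_nonneg _ _)]
    intro x
    obtain ⟨φ, hφ, hφx⟩ := exists_dual_vector'' ℂ (tensorToFunAlg K F t x)
    let ev : nuclearAlgebra K →L[ℂ] ℂ :=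
      LinearMap.mkContinuous
        { toFun := fun f => f.1 x, map_add' := fun _ _ => rfl, map_smul' := fun _ _ => rfl } 1
        (fun f => by
          rw [one_mul]
          exact f.1.norm_coe_le_norm x)
    have hev : ‖ev‖ ≤ 1 := LinearMap.mkContinuous_norm_le _ zero_le_one _
    have h1 : ∀ s, φ (tensorToFunAlg K F s x) = evalPair (ev, φ) s := by
      intro s
      induction s using TensorProduct.induction_on with
      | zero => simp
      | tmul f a => 
        rw [tensorToFunAlg_tmul, map_smul]
        rfl
      | add s t hs ht => rw [map_add, map_add, ContinuousMap.add_apply, map_add, hs, ht]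
    have h2 : ‖tensorToFunAlg K F t x‖ = ‖evalPair (ev, φ) t‖ := by
      rw [← h1, hφx]
      simp
    rw [h2]
    exact le_ciSup (evalPair_bdd t) (⟨(ev, φ), hev, hφ⟩ : dualBallPairs (nuclearAlgebra K) F)
  · refine ciSup_le fun p => ?_
    obtain ⟨⟨ψ, φ⟩, hψ, hφ⟩ := p
    have h1 : ∀ s, ∃ g : nuclearAlgebra K, (∀ x, g.1 x = φ (tensorToFunAlg K F s x)) ∧
        evalPair (ψ, φ) s = ψ g := by
      intro s
      induction s using TensorProduct.induction_on with
      | zero => exact ⟨0, by simp, by simp⟩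
      | tmul f a =>
        refine ⟨φ a • f, fun x => ?_, ?_⟩
        · simp [tensorToFunAlg_tmul, mul_comm]
        · simp [evalPair, mul_comm]
      | add s t hs ht =>
        obtain ⟨g, hg, hgs⟩ := hs
        obtain ⟨h, hh, hht⟩ := ht
        exact ⟨g + h, fun x => by simp [hg, hh], by rw [map_add, map_add, hgs, hht]⟩
    obtain ⟨g, hg, hgt⟩ := h1 t
    have hgn : ‖g‖ ≤ ‖tensorToFunAlg K F t‖ := by
      change ‖g.1‖ ≤ _
      rw [ContinuousMap.norm_le _ (norm_nonneg _)]
      intro x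
      rw [hg]
      exact (φ.le_of_opNorm_le hφ _).trans (by
        simpa using (tensorToFunAlg K F t).norm_coe_le_norm x)
    change ‖evalPair (ψ, φ) t‖ ≤ _
    rw [hgt]
    exact (ψ.le_of_opNorm_le hψ g).trans ((one_mul ‖g‖).le.trans hgn)

/-- The canonical map `Λ : 𝒫_N(K) ⊗̂_ε F → C(K, F)`, the extension by continuity of
`f ⊗ a ↦ (x ↦ f(x) a)`. It is isometric, and `𝒫_N(K) ⊗̂_ε F` is identified with its range. -/
def tensorToFun (K : TopologicalSpace.Compacts E) (F : Type*) [NormedAddCommGroup F]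
    [NormedSpace ℂ F] [CompleteSpace F] :
    CompletedInjTensor (nuclearAlgebra K) F →L[ℂ] C(K, F) :=
  ContinuousLinearMap.extend
    (LinearMap.mkContinuous (E := InjTensor (nuclearAlgebra K) F) (tensorToFunAlg K F) 1
      (fun t => by
        rw [one_mul]
        exact (norm_tensorToFunAlg K F t).le))
    (UniformSpace.Completion.toComplL (𝕜 := ℂ) (E := InjTensor (nuclearAlgebra K) F))

theorem tensorToFun_coe (K : TopologicalSpace.Compacts E) (F : Type*) [NormedAddCommGroup F]
    [NormedSpace ℂ F] [CompleteSpace F] (t : InjTensor (nuclearAlgebra K) F) :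
    tensorToFun K F (t : CompletedInjTensor (nuclearAlgebra K) F) = tensorToFunAlg K F t :=
  ContinuousLinearMap.extend_eq _ UniformSpace.Completion.denseRange_coe
    (UniformSpace.Completion.isUniformInducing_coe _) t

theorem tensorToFun_isometry (K : TopologicalSpace.Compacts E) (F : Type*)
    [NormedAddCommGroup F] [NormedSpace ℂ F] [CompleteSpace F] :
    Isometry (tensorToFun K F) := by
  refine AddMonoidHomClass.isometry_of_norm _ fun u => ?_
  induction u using UniformSpace.Completion.induction_on with
  | hp => exact isClosed_eq (tensorToFun K F).continuous.norm continuous_norm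
  | ih t =>
    rw [tensorToFun_coe, UniformSpace.Completion.norm_coe]
    exact norm_tensorToFunAlg K F t

/-- The equality `ℙ(K, A) = 𝒫_N(K) ⊗̂_ε A`, as subspaces of `C(K, A)`. -/
def PolyEqTensor (K : TopologicalSpace.Compacts E) (A : Type v) [NormedCommRing A]
    [NormedAlgebra ℂ A] [CompleteSpace A] : Prop :=
  Set.range (tensorToFun K A) = (polyAlgebra K A : Set C(K, A))

/-- The identity operator `I : E → E` belongs to `𝒫_N(K) ⊗̂_ε E` (as a function on `K`). -/
def IdMemTensor [CompleteSpace E] (K : TopologicalSpace.Compacts E) : Prop :=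
  (⟨fun x => (x : E), continuous_subtype_val⟩ : C(K, E)) ∈ Set.range (tensorToFun K E)

end Representation

/-- The approximation property: the identity is approximated, uniformly on every compact set,
by finite rank bounded operators. -/
def HasApproximationProperty (X : Type*) [NormedAddCommGroup X] [NormedSpace ℂ X] : Prop :=
  ∀ ε > (0 : ℝ), ∀ C : Set X, IsCompact C →
    ∃ T : X →L[ℂ] X, FiniteDimensional ℂ (LinearMap.range (T : X →ₗ[ℂ] X)) ∧
      ∀ x ∈ C, ‖T x - x‖ < ε

/-- The characters of `A` generate `A*` in the topology of compact convergence: their linear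
span is dense. -/
def CharactersGenerate (A : Type*) [NormedCommRing A] [NormedAlgebra ℂ A] : Prop :=
  Dense (Submodule.span ℂ {ℓ : A →L_c[ℂ] ℂ |
    ∃ χ : WeakDual.characterSpace ℂ A, ∀ a, ℓ a = χ a} : Set (A →L_c[ℂ] ℂ))

end GenPoly
end

/-! A character of `ℙ(K, A)` should be an evaluation at a point of `K̂_N` followed by a character of
`A`. Three facts carry this.

Points come from functionals. A linear form on `E*` bounded by the supremum over `K` is evaluation
at a point of a compact convex hull of `K` (`exists_barycenter`, by Hahn–Banach and compactness).
Applied to evaluations, it shows that `K̂_N` is compact; applied to a character of `𝒫_N(K)`, it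
yields the point representing that character, and that point lies in `K̂_N`
(`exists_mem_nuclearHull`).

Pairs give characters. For a character `φ` of `A` and `P` in `ℙ(E, A)`, `φ ∘ P` is a nuclear
polynomial, so `|φ(P a)| ≤ ‖P‖_K` for `a` in the hull, and `P ↦ φ(P a)` extends to `ℙ(K, A)`
(`exists_character`). The resulting `j` is continuous and injective from a compact space to a
Hausdorff one, hence a closed embedding.

The algebra is generated by constants and operators (`polyAlgebra_le`). Thus `ℙ(K, A)` is the tensor
product as soon as every `T|_K` lies in the latter (`polyEqTensor_of_restrOp_mem`), which each of
the four conditions ensures. In that case a character is determined by its restrictions to `𝒫_N(K)`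
and to `A`, which makes `j` surjective (`PolyEqTensor.surjective`). -/

noncomputable section

namespace GenPoly

/-! ### Barycenters: representing functionals on the dual by points -/

section Barycenter

variable {E : Type u} [NormedAddCommGroup E] [NormedSpace ℂ E]

/-- The closed absolutely convex hull, over the complex scalars, of `K ∪ {0}`. -/
def complexHull (K : Set E) : Set E :=
  closedAbsConvexHull ℝ
    ((fun p : ℂ × E => p.1 • p.2) '' (Metric.closedBall (0 : ℂ) 1 ×ˢ insert 0 K))

theorem isCompact_complexHull [CompleteSpace E] {K : Set E} (hK : IsCompact K) :
    IsCompact (complexHull K) := by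
  refine isCompact_closedAbsConvexHull_of_totallyBounded (IsCompact.totallyBounded ?_)
  exact ((isCompact_closedBall (0 : ℂ) 1).prod (hK.insert 0)).image (by fun_prop)

theorem smul_mem_complexHull {K : Set E} {c : ℂ} (hc : ‖c‖ ≤ 1) {x : E} (hx : x ∈ insert 0 K) :
    c • x ∈ complexHull K :=
  subset_closedAbsConvexHull ⟨(c, x), ⟨by simpa using hc, hx⟩, rfl⟩

/-- A linear functional on the dual of `E` which is dominated by the supremum over a compact set
is the evaluation at a point of the closed absolutely convex hull. -/
theorem exists_barycenter [CompleteSpace E] {K : Set E} (hK : IsCompact K)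
    (ψ : (E →L[ℂ] ℂ) →ₗ[ℂ] ℂ)
    (hψ : ∀ (l : E →L[ℂ] ℂ) (r : ℝ), 0 ≤ r → (∀ x ∈ K, ‖l x‖ ≤ r) → ‖ψ l‖ ≤ r) :
    ∃ a ∈ complexHull K, ∀ l, ψ l = l a := by
  classical
  suffices h : (complexHull K ∩ ⋂ l : E →L[ℂ] ℂ, {a | l a = ψ l}).Nonempty by
    obtain ⟨a, ha, hl⟩ := h
    exact ⟨a, ha, fun l => (Set.mem_iInter.1 hl l).symm⟩
  -- By compactness it is enough to match finitely many functionals at once, a separation problem in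
  -- `ℂ^s`.
  refine (isCompact_complexHull hK).inter_iInter_nonempty _
    (fun l => isClosed_eq l.continuous continuous_const) fun s => ?_
  let Φ : E →L[ℂ] (s → ℂ) := ContinuousLinearMap.pi fun l => l.1
  let y : s → ℂ := fun l => ψ l.1
  by_contra hne
  have hy : y ∉ Φ '' complexHull K := by
    rintro ⟨a, ha, hay⟩
    refine hne ⟨a, ha, Set.mem_iInter₂.2 fun l hl => ?_⟩
    exact congrFun hay ⟨l, hl⟩
  have hconv : Convex ℝ (Φ '' complexHull K) :=
    (absConvex_convexClosedHull (𝕜 := ℝ)).2.linear_image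
      (Φ.restrictScalars ℝ : E →ₗ[ℝ] (s → ℂ))
  have hcl : IsClosed (Φ '' complexHull K) :=
    ((isCompact_complexHull hK).image Φ.continuous).isClosed
  obtain ⟨f, r, hf, hr⟩ := RCLike.geometric_hahn_banach_closed_point (𝕜 := ℂ) hconv hcl hy
  -- The point `0` was inserted into the hull so that this holds even for empty `K`.
  have hr0 : 0 ≤ r := by
    have h0 : (0 : ℂ) • (0 : E) ∈ complexHull K :=
      smul_mem_complexHull (by simp) (Set.mem_insert 0 K)
    simpa using (hf _ ⟨_, h0, rfl⟩).le
  -- `f ∘ Φ` is a linear combination of the functionals in `s`, so linearity of `ψ` computes its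
  -- value.
  have hfy : ψ (f.comp Φ) = f y := by
    let e : s → s → ℂ := fun i k => if i = k then 1 else 0
    have h1 : ∀ z : s → ℂ, f z = ∑ i, z i * f (e i) :=
      (f : (s → ℂ) →ₗ[ℂ] ℂ).pi_apply_eq_sum_univ
    have h2 : f.comp Φ = ∑ i : s, f (e i) • i.1 := by
      ext x
      simp only [ContinuousLinearMap.comp_apply, h1 (Φ x), sum_apply,
        smul_apply, smul_eq_mul, mul_comm]
      rfl
    rw [h2, h1 y, map_sum]
    exact Finset.sum_congr rfl fun i _ => by rw [map_smul, smul_eq_mul, mul_comm]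
  have hle : ‖ψ (f.comp Φ)‖ ≤ r := by
    refine hψ _ _ hr0 fun x hx => ?_
    -- The hull contains all unimodular multiples of `x`; rotating turns the bound on the real part
    -- into a bound on the modulus.
    obtain ⟨c, hc, hcx⟩ := RCLike.exists_norm_eq_mul_self (f (Φ x))
    have := hf _ ⟨c • x, smul_mem_complexHull hc.le (Set.mem_insert_of_mem 0 hx), rfl⟩
    rw [map_smul, map_smul, smul_eq_mul, ← hcx] at this
    simpa using this.le
  rw [hfy] at hle
  exact absurd (hr.trans_le (RCLike.re_le_norm _)) (not_lt.2 hle)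

end Barycenter

/-! ### Characters are contractive -/

section Characters

variable {R : Type*} [NormedRing R] [NormedAlgebra ℂ R]

/-- If `|ψ x| > ‖x‖`, then `|ψ x|ᵐ ≤ ‖ψ‖ ‖x‖ᵐ` fails for large `m`. Neither completeness of `R` nor
`‖1‖ = 1` is assumed, so only exponents `m > 0` are used. -/
theorem norm_algHom_apply_le (ψ : R →ₐ[ℂ] ℂ) (hψ : Continuous ψ) (x : R) : ‖ψ x‖ ≤ ‖x‖ := by
  let f : R →L[ℂ] ℂ := ⟨ψ.toLinearMap, hψ⟩
  by_contra! h
  have hx : 0 < ‖x‖ := by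
    refine norm_pos_iff.2 fun hx => ?_
    simp [hx] at h
  obtain ⟨n, hn⟩ := pow_unbounded_of_one_lt ‖f‖ ((one_lt_div hx).2 h)
  have h1 : ∀ m : ℕ, 0 < m → (‖ψ x‖ / ‖x‖) ^ m ≤ ‖f‖ := by
    intro m hm
    rw [div_pow, div_le_iff₀ (by positivity), ← norm_pow, ← map_pow]
    exact (f.le_opNorm _).trans
      (mul_le_mul_of_nonneg_left (norm_pow_le' x hm) (norm_nonneg _))
  have h2 := h1 (n + 1) n.succ_pos
  have h3 : (‖ψ x‖ / ‖x‖) ^ n ≤ (‖ψ x‖ / ‖x‖) ^ (n + 1) :=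
    pow_le_pow_right₀ ((one_lt_div hx).2 h).le n.le_succ
  linarith

/-- The character of `R` given by a continuous algebra homomorphism. -/
def characterOfAlgHom (ψ : R →ₐ[ℂ] ℂ) (hψ : Continuous ψ) : WeakDual.characterSpace ℂ R :=
  ⟨StrongDual.toWeakDual ⟨ψ.toLinearMap, hψ⟩, fun h => one_ne_zero (α := ℂ) (by
    have : ψ 1 = 0 := DFunLike.congr_fun h (1 : R)
    rwa [map_one] at this), fun x y => map_mul ψ x y⟩

theorem norm_character_apply_le (χ : WeakDual.characterSpace ℂ R) (x : R) : ‖χ x‖ ≤ ‖x‖ :=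
  norm_algHom_apply_le (WeakDual.CharacterSpace.toAlgHom χ) (map_continuous χ) x

end Characters

/-! ### Restriction to smaller compact sets -/

section Restriction

variable {E : Type u} [NormedAddCommGroup E]
variable {A : Type v} [NormedCommRing A] [NormedAlgebra ℂ A]

/-- Restriction of continuous functions to a smaller compact set. -/
def restrHom {K L : TopologicalSpace.Compacts E} (h : (K : Set E) ⊆ L) (A : Type v)
    [NormedCommRing A] [NormedAlgebra ℂ A] : C(L, A) →ₐ[ℂ] C(K, A) :=
  ContinuousMap.compRightAlgHom ℂ A ⟨Set.inclusion h, continuous_inclusion h⟩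

theorem continuous_restrHom {K L : TopologicalSpace.Compacts E} (h : (K : Set E) ⊆ L) :
    Continuous (restrHom h A) :=
  ContinuousMap.continuous_precomp _

end Restriction

/-! ### Continuity of polynomials and generators of `ℙ(K, A)` -/

section Algebra

variable {E : Type u} [NormedAddCommGroup E] [NormedSpace ℂ E]
variable {A : Type v} [NormedCommRing A] [NormedAlgebra ℂ A]

theorem IsHomogeneousGen.continuous [CompleteSpace A] {n : ℕ} {P : E → A}
    (hP : IsHomogeneousGen n P) : Continuous P := by
  rcases hP with ⟨_, c, hc⟩ | ⟨hn, T, hT, hPT⟩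
  · exact (funext hc : P = fun _ => c) ▸ continuous_const
  · have hP' : P = fun x => ∑' i, T i x ^ n := funext fun x => (hPT x).tsum_eq.symm
    refine continuous_iff_continuousAt.2 fun x => ?_
    -- Weierstrass M-test on a ball around the origin containing `x`.
    have : ContinuousOn P (Metric.ball 0 (‖x‖ + 1)) := by
      rw [hP']
      refine continuousOn_tsum (fun i => by fun_prop) (hT.mul_right ((‖x‖ + 1) ^ n))
        fun i y hy => ?_
      rw [← mul_pow]
      refine (norm_pow_le' _ (Nat.pos_of_ne_zero hn)).trans ?_
      gcongr
      exact (T i).le_opNorm_of_le (by simpa using (mem_ball_zero_iff.1 hy).le)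
    exact this.continuousAt (Metric.isOpen_ball.mem_nhds (by simp))

theorem continuous_of_mem_polySpace [CompleteSpace A] {P : E → A} (hP : P ∈ polySpace E A) :
    Continuous P := by
  obtain ⟨n, Q, hQ, hPQ⟩ := hP
  rw [funext hPQ]
  exact continuous_finsetSum _ fun k hk =>
    (hQ k (Nat.lt_succ_iff.1 (Finset.mem_range.1 hk))).continuous

theorem IsHomogeneousGen.character_comp {n : ℕ} {P : E → A} (hP : IsHomogeneousGen n P)
    (φ : WeakDual.characterSpace ℂ A) : IsHomogeneousGen n fun x => φ (P x) := by
  rcases hP with ⟨hn, c, hc⟩ | ⟨hn, T, hT, hPT⟩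
  · exact Or.inl ⟨hn, φ c, fun x => congrArg φ (hc x)⟩
  · refine Or.inr ⟨hn, fun i => (WeakDual.CharacterSpace.toCLM φ).comp (T i), ?_, fun x => ?_⟩
    · refine Summable.of_nonneg_of_le (fun i => by positivity) (fun i => ?_) hT
      gcongr
      refine ContinuousLinearMap.opNorm_le_bound _ (norm_nonneg _) fun x => ?_
      exact (norm_character_apply_le φ _).trans ((T i).le_opNorm x)
    · have := (hPT x).map φ (map_continuous φ)
      simpa [Function.comp_def] using this

theorem character_comp_mem_polySpace {P : E → A} (hP : P ∈ polySpace E A)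
    (φ : WeakDual.characterSpace ℂ A) : (fun x => φ (P x)) ∈ polySpace E ℂ := by
  obtain ⟨n, Q, hQ, hPQ⟩ := hP
  exact ⟨n, fun k x => φ (Q k x), fun k hk => (hQ k hk).character_comp φ, fun x =>
    (congrArg φ (hPQ x)).trans (map_sum φ _ _)⟩

theorem const_mem_polySpace (c : A) : (fun _ => c) ∈ polySpace E A :=
  IsHomogeneousGen.mem_polySpace (n := 0) (Or.inl ⟨rfl, c, fun _ => rfl⟩)

theorem clm_mem_polySpace (T : E →L[ℂ] A) : (fun x => T x) ∈ polySpace E A := by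
  refine IsHomogeneousGen.mem_polySpace (n := 1) (Or.inr ⟨one_ne_zero,
    fun i => if i = 0 then T else 0, ?_, fun x => ?_⟩)
  · refine summable_of_ne_finset_zero (s := {0}) fun i hi => ?_
    simp only [Finset.mem_singleton] at hi
    simp [hi]
  · have := hasSum_single (f := fun i : ℕ => (if i = 0 then T else 0) x ^ 1) 0
      (fun i hi => by simp [hi])
    simpa using this

variable [CompleteSpace A]

theorem coe_polyAlgebra (K : TopologicalSpace.Compacts E) :
    (polyAlgebra K A : Set C(K, A)) = closure (polyRestr K A) := rfl

theorem isClosed_polyAlgebra (K : TopologicalSpace.Compacts E) :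
    IsClosed (polyAlgebra K A : Set C(K, A)) :=
  isClosed_closure

theorem genAlg_le_polyAlgebra (K : TopologicalSpace.Compacts E) :
    genAlg K A ≤ polyAlgebra K A :=
  fun _ hf => subset_closure (genAlg_subset K hf)

/-- Constants and powers of operators span a dense subspace of `ℙ(K, A)` (`closure_polyRestr`), so a
closed subalgebra need only be tested on constants and operators. Infinite series never have to be
handled again. -/
theorem polyAlgebra_le {K : TopologicalSpace.Compacts E} {S : Subalgebra ℂ C(K, A)}
    (hS : IsClosed (S : Set C(K, A))) (hc : ∀ c, ContinuousMap.const K c ∈ S)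
    (hT : ∀ T, restrCLM K T ∈ S) : polyAlgebra K A ≤ S := by
  intro f hf
  rw [← SetLike.mem_coe, coe_polyAlgebra, closure_polyRestr] at hf
  refine closure_minimal (fun g hg => ?_) hS hf
  refine (Submodule.span_le (p := Subalgebra.toSubmodule S)).2 ?_ hg
  rintro _ (⟨c, rfl⟩ | ⟨n, T, _, rfl⟩)
  exacts [hc c, pow_mem (hT T) n]

/-- Constant functions as elements of `ℙ(K, A)`. -/
def polyConst (K : TopologicalSpace.Compacts E) (c : A) : polyAlgebra K A :=
  ⟨ContinuousMap.const K c,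
    genAlg_le_polyAlgebra K (Submodule.subset_span (Or.inl ⟨c, rfl⟩))⟩

/-- Bounded linear operators as elements of `ℙ(K, A)`. -/
def polyOp (K : TopologicalSpace.Compacts E) (T : E →L[ℂ] A) : polyAlgebra K A :=
  ⟨restrCLM K T, genAlg_le_polyAlgebra K
    (Submodule.subset_span (Or.inr ⟨1, T, one_ne_zero, (pow_one _).symm⟩))⟩

theorem polyAlgebra_eq_top {K : TopologicalSpace.Compacts E}
    {S : Subalgebra ℂ (polyAlgebra K A)} (hS : IsClosed (S : Set (polyAlgebra K A)))
    (hc : ∀ c, polyConst K c ∈ S) (hT : ∀ T, polyOp K T ∈ S) : S = ⊤ := by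
  have hcl : IsClosed (S.map (polyAlgebra K A).val : Set C(K, A)) := by
    rw [Subalgebra.coe_map]
    exact (isClosed_polyAlgebra K).isClosedEmbedding_subtypeVal.isClosedMap _ hS
  have hle : polyAlgebra K A ≤ S.map (polyAlgebra K A).val :=
    polyAlgebra_le hcl (fun c => ⟨_, hc c, rfl⟩) fun T => ⟨_, hT T, rfl⟩
  refine eq_top_iff.2 fun f _ => ?_
  obtain ⟨g, hg, hgf⟩ := hle f.2
  rwa [← Subtype.ext hgf]

theorem polyAlgebra_algHom_ext {K : TopologicalSpace.Compacts E}
    {Φ Ψ : polyAlgebra K A →ₐ[ℂ] ℂ} (hΦ : Continuous Φ) (hΨ : Continuous Ψ)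
    (hc : ∀ c, Φ (polyConst K c) = Ψ (polyConst K c))
    (hT : ∀ T, Φ (polyOp K T) = Ψ (polyOp K T)) : Φ = Ψ := by
  have h : AlgHom.equalizer Φ Ψ = ⊤ :=
    polyAlgebra_eq_top (isClosed_eq hΦ hΨ) hc hT
  ext f
  exact (h ▸ Algebra.mem_top : f ∈ AlgHom.equalizer Φ Ψ)

theorem exists_polyAlgebra_eq (K : TopologicalSpace.Compacts E) {P : E → A}
    (hP : P ∈ polySpace E A) : ∃ f : polyAlgebra K A, ∀ x : K, (f : C(K, A)) x = P x :=
  ⟨⟨⟨fun x => P x, (continuous_of_mem_polySpace hP).comp continuous_subtype_val⟩,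
    subset_closure ⟨P, hP, fun _ => rfl⟩⟩, fun _ => rfl⟩

theorem restrHom_mem {K L : TopologicalSpace.Compacts E} (h : (K : Set E) ⊆ L) {f : C(L, A)}
    (hf : f ∈ polyAlgebra L A) : restrHom h A f ∈ polyAlgebra K A :=
  map_mem_closure (continuous_restrHom h) hf fun _ ⟨P, hP, hfP⟩ =>
    ⟨P, hP, fun x => hfP ⟨x, h x.2⟩⟩

/-- Restriction `ℙ(L, A) → ℙ(K, A)` for `K ⊆ L`. -/
def restrPoly {K L : TopologicalSpace.Compacts E} (h : (K : Set E) ⊆ L) (A : Type v)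
    [NormedCommRing A] [NormedAlgebra ℂ A] [CompleteSpace A] :
    polyAlgebra L A →ₐ[ℂ] polyAlgebra K A :=
  ((restrHom h A).comp (polyAlgebra L A).val).codRestrict _ fun f => restrHom_mem h f.2

end Algebra

end GenPoly
namespace GenPoly

/-! ### Compactness of the nuclear hull and characters of `𝒫_N(K)` -/

section Hull

variable {E : Type u} [NormedAddCommGroup E] [NormedSpace ℂ E]

theorem bddAbove_range_norm {A : Type*} [NormedCommRing A] [NormedAlgebra ℂ A] [CompleteSpace A]
    (K : TopologicalSpace.Compacts E) {P : E → A} (hP : P ∈ polySpace E A) :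
    BddAbove (Set.range fun x : K => ‖P x‖) := by
  have : Continuous fun x : K => ‖P x‖ :=
    ((continuous_of_mem_polySpace hP).comp continuous_subtype_val).norm
  exact (isCompact_range this).bddAbove

theorem subset_nuclearHull (K : TopologicalSpace.Compacts E) : (K : Set E) ⊆ nuclearHull K :=
  fun x hx _ hP => le_ciSup (bddAbove_range_norm K hP) ⟨x, hx⟩

theorem isClosed_nuclearHull (K : TopologicalSpace.Compacts E) : IsClosed (nuclearHull K) := by
  have : nuclearHull K = ⋂ P ∈ polySpace E ℂ, {a | ‖P a‖ ≤ ⨆ x : K, ‖P x‖} := by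
    ext a
    simp [nuclearHull]
  rw [this]
  exact isClosed_biInter fun P hP =>
    isClosed_le (continuous_of_mem_polySpace hP).norm continuous_const

/-- Bounded functionals are nuclear polynomials, so for `a` in the hull `l ↦ l a` is dominated by
the supremum over `K`. Its barycenter has the same values under all `l`, hence is `a`. This is what
makes the hull compact. -/
theorem nuclearHull_subset_complexHull [CompleteSpace E] (K : TopologicalSpace.Compacts E) :
    nuclearHull K ⊆ complexHull K := by
  intro a ha
  obtain ⟨b, hb, hab⟩ := exists_barycenter K.isCompact
    (LinearMap.applyₗ a ∘ₗ ContinuousLinearMap.coeLM ℂ) fun l r hr hl =>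
      (ha _ (clm_mem_polySpace l)).trans (Real.iSup_le (fun x => hl x x.2) hr)
  have : a = b := (SeparatingDual.eq_iff_forall_dual_eq (R := ℂ)).2 fun l => hab l
  rwa [this]

theorem isCompact_nuclearHull [CompleteSpace E] (K : TopologicalSpace.Compacts E) :
    IsCompact (nuclearHull K) :=
  (isCompact_complexHull K.isCompact).of_isClosed_subset (isClosed_nuclearHull K)
    (nuclearHull_subset_complexHull K)

/-- A character of `𝒫_N(K)` is the evaluation at a point of the nuclear hull of `K`. -/
theorem exists_mem_nuclearHull [CompleteSpace E] {K : TopologicalSpace.Compacts E}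
    (ψ : nuclearAlgebra K →ₐ[ℂ] ℂ) (hψ : Continuous ψ) :
    ∃ a ∈ nuclearHull K, ∀ l, ψ (polyOp K l) = l a := by
  have hle : ∀ (f : nuclearAlgebra K) (r : ℝ), 0 ≤ r → (∀ x : K, ‖(f : C(K, ℂ)) x‖ ≤ r) →
      ‖ψ f‖ ≤ r := fun f r hr hf =>
    (norm_algHom_apply_le ψ hψ f).trans ((ContinuousMap.norm_le _ hr).2 hf)
  obtain ⟨a, -, ha⟩ := exists_barycenter K.isCompact
    { toFun := fun l => ψ (polyOp K l)
      map_add' := fun l m => ψ.map_add' (polyOp K l) (polyOp K m)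
      map_smul' := fun c l => ψ.toLinearMap.map_smul c (polyOp K l) }
    fun l r hr hl => hle (polyOp K l) r hr fun x => hl x x.2
  have ha' : ∀ l, ψ (polyOp K l) = l a := ha
  refine ⟨a, fun P hP => ?_, ha'⟩
  -- On `K ∪ {a}`, both "restrict to `K`, then apply `ψ`" and "evaluate at `a`" are continuous
  -- characters. They agree on constants and functionals, hence everywhere, which gives `ψ(P|_K) = P
  -- a`.
  let L : TopologicalSpace.Compacts E := ⟨insert a K, K.isCompact.insert a⟩
  have hKL : (K : Set E) ⊆ L := Set.subset_insert a K
  let aL : L := ⟨a, Set.mem_insert a K⟩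
  obtain ⟨f, hf⟩ := exists_polyAlgebra_eq L hP
  have hext : ψ.comp (restrPoly hKL ℂ) =
      (ContinuousMap.evalAlgHom ℂ ℂ aL).comp (polyAlgebra L ℂ).val := by
    refine polyAlgebra_algHom_ext (hψ.comp ?_) ?_ (fun c => ?_) fun l => ha' l
    · exact ((continuous_restrHom hKL).comp continuous_subtype_val).subtype_mk _
    · exact (continuous_eval_const aL).comp continuous_subtype_val
    · exact AlgHomClass.commutes ψ c
  have hfa : ψ (restrPoly hKL ℂ f) = P a := (DFunLike.congr_fun hext f).trans (hf aL)
  rw [← hfa]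
  refine hle _ _ (Real.iSup_nonneg fun _ => norm_nonneg _) fun x => ?_
  have : (restrPoly hKL ℂ f : C(K, ℂ)) x = P x := hf ⟨x, hKL x.2⟩
  rw [this]
  exact le_ciSup (bddAbove_range_norm K hP) x

end Hull

/-! ### Construction of the characters and the closed embedding -/

section Extension

variable {E : Type u} [NormedAddCommGroup E] [NormedSpace ℂ E]
variable {A : Type v} [NormedCommRing A] [NormedAlgebra ℂ A] [CompleteSpace A]

/-- A family of characters `P|_K ↦ φ (P a)` is jointly continuous in `(a, φ)`. -/
theorem continuous_of_eval {K : TopologicalSpace.Compacts E}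
    {j : nuclearHull K × WeakDual.characterSpace ℂ A →
      WeakDual.characterSpace ℂ (polyAlgebra K A)}
    (hc : ∀ p c, j p (polyConst K c) = p.2 c) (hT : ∀ p T, j p (polyOp K T) = p.2 (T p.1)) :
    Continuous j := by
  have heval : ∀ c : A, Continuous fun p : nuclearHull K × WeakDual.characterSpace ℂ A => p.2 c :=
    fun c => (WeakDual.eval_continuous c).comp (continuous_subtype_val.comp continuous_snd)
  let S : Subalgebra ℂ (polyAlgebra K A) :=
    { carrier := {f | Continuous fun p => j p f}
      mul_mem' := fun {f g} hf hg => by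
        change Continuous fun p => j p (f * g)
        simp only [map_mul]
        exact Continuous.mul hf hg
      add_mem' := fun {f g} hf hg => by
        change Continuous fun p => j p (f + g)
        simp only [map_add]
        exact Continuous.add hf hg
      algebraMap_mem' := fun c => by
        change Continuous fun p => j p (algebraMap ℂ _ c)
        simp only [AlgHomClass.commutes]
        exact continuous_const }
  have hScl : IsClosed (S : Set (polyAlgebra K A)) := by
    refine isClosed_of_closure_subset fun f hf => ?_
    refine continuous_of_uniform_approx_of_continuous fun u hu => ?_
    obtain ⟨ε, hε, hu⟩ := Metric.mem_uniformity_dist.1 hu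
    obtain ⟨g, hg, hfg⟩ := Metric.mem_closure_iff.1 hf ε hε
    -- Characters are contractive, so norm approximation of `f` by `g` is uniform in `p`.
    refine ⟨fun p => j p g, hg, fun p => hu ?_⟩
    rw [dist_eq_norm, ← map_sub]
    exact (norm_character_apply_le (j p) _).trans_lt (by rwa [← dist_eq_norm])
  have hStop : S = ⊤ := by
    refine polyAlgebra_eq_top hScl (fun c => ?_) fun T => ?_
    · change Continuous fun p => j p (polyConst K c)
      simpa only [hc] using heval c
    · change Continuous fun p => j p (polyOp K T)
      simp only [hT]
      refine continuous_iff_continuousAt.2 fun p₀ => ?_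
      -- Split `φ(T a) = φ(T a - T a₀) + φ(T a₀)`: the first term is at most `‖T a - T a₀‖`
      -- uniformly in `φ`, the second depends on `φ` alone.
      have h1 : Filter.Tendsto
          (fun p : nuclearHull K × WeakDual.characterSpace ℂ A => p.2 (T p.1 - T p₀.1))
          (nhds p₀) (nhds 0) := by
        refine squeeze_zero_norm (fun p => norm_character_apply_le p.2 _) ?_
        have : Continuous fun p : nuclearHull K × WeakDual.characterSpace ℂ A =>
            ‖T p.1 - T p₀.1‖ := by fun_prop
        simpa using this.tendsto p₀
      have h2 := h1.add ((heval (T p₀.1)).tendsto p₀)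
      simp only [← map_add, sub_add_cancel, zero_add] at h2
      exact h2
  refine Continuous.subtype_mk (WeakDual.continuous_of_continuous_eval fun f => ?_) _
  exact (hStop ▸ Algebra.mem_top : f ∈ S)

variable [CompleteSpace E]

/-- The characters `P|_K ↦ φ (P a)` of `ℙ(K, A)`. -/
theorem exists_character (K : TopologicalSpace.Compacts E) {a : E} (ha : a ∈ nuclearHull K)
    (φ : WeakDual.characterSpace ℂ A) :
    ∃ χ : WeakDual.characterSpace ℂ (polyAlgebra K A), ∀ P ∈ polySpace E A,
      ∀ f : polyAlgebra K A, (∀ x : K, (f : C(K, A)) x = P x) → χ f = φ (P a) := by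
  let L : TopologicalSpace.Compacts E := ⟨nuclearHull K, isCompact_nuclearHull K⟩
  have hKL : (K : Set E) ⊆ L := subset_nuclearHull K
  let aL : L := ⟨a, ha⟩
  let ev : C(L, A) →ₐ[ℂ] ℂ :=
    (WeakDual.CharacterSpace.toAlgHom φ).comp (ContinuousMap.evalAlgHom ℂ A aL)
  have hev : Continuous ev := (map_continuous φ).comp (continuous_eval_const aL)
  -- On polynomials: `|φ(P a)| ≤ sup_K |φ ∘ P| ≤ ‖P‖_K`, since `φ ∘ P` is a nuclear polynomial. The
  -- rest follows by closure.
  have hbound : ∀ f ∈ polyAlgebra L A, ‖ev f‖ ≤ ‖restrHom hKL A f‖ := by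
    intro f hf
    refine closure_minimal (s := polyRestr L A) (t := {f | ‖ev f‖ ≤ ‖restrHom hKL A f‖}) ?_
      (isClosed_le hev.norm (continuous_restrHom hKL).norm) hf
    rintro g ⟨P, hP, hgP⟩
    have h1 : ev g = φ (P a) := congrArg φ (hgP aL)
    change ‖ev g‖ ≤ _
    rw [h1]
    refine (ha _ (character_comp_mem_polySpace hP φ)).trans
      (Real.iSup_le (fun x => ?_) (norm_nonneg _))
    refine (norm_character_apply_le φ _).trans ?_
    have h2 : restrHom hKL A g x = P x := hgP _
    rw [← h2]
    exact ContinuousMap.norm_coe_le_norm _ x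
  -- `S` is the closed graph of the desired character. By `hS` the first projection is isometric on
  -- it, so the projection has closed range, which contains `ℙ(K, A)`; inverting it and taking the
  -- second coordinate gives a well-defined character.
  let S : Subalgebra ℂ (C(K, A) × ℂ) :=
    ((polyAlgebra L A).map ((restrHom hKL A).prod ev)).topologicalClosure
  have hS : ∀ p ∈ S, ‖p.2‖ ≤ ‖p.1‖ := by
    intro p hp
    refine closure_minimal (t := {p : C(K, A) × ℂ | ‖p.2‖ ≤ ‖p.1‖}) ?_
      (isClosed_le continuous_snd.norm continuous_fst.norm) hp
    rintro _ ⟨f, hf, rfl⟩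
    exact hbound f hf
  have hmem : ∀ P ∈ polySpace E A, ∀ f : C(K, A), (∀ x : K, f x = P x) → (f, φ (P a)) ∈ S := by
    intro P hP f hf
    obtain ⟨g, hg⟩ := exists_polyAlgebra_eq L hP
    refine subset_closure ⟨g, g.2, Prod.ext ?_ ?_⟩
    · ext x
      exact (hg ⟨x, hKL x.2⟩).trans (hf x).symm
    · exact congrArg φ (hg aL)
  let F : S →ₐ[ℂ] C(K, A) := (AlgHom.fst ℂ C(K, A) ℂ).comp S.val
  have hF : Isometry F := by
    refine AddMonoidHomClass.isometry_of_norm F fun p => ?_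
    exact (max_eq_left (hS p p.2)).symm
  have hScl : IsClosed (S : Set (C(K, A) × ℂ)) := Subalgebra.isClosed_topologicalClosure _
  have : CompleteSpace S := hScl.completeSpace_coe
  have hrange : polyAlgebra K A ≤ F.range := by
    intro f hf
    have hcl : IsClosed (Set.range F) := hF.isClosedEmbedding.isClosed_range
    refine closure_minimal ?_ hcl hf
    rintro f ⟨P, hP, hfP⟩
    exact ⟨⟨_, hmem P hP f hfP⟩, rfl⟩
  let e : S ≃ₐ[ℂ] F.range := AlgEquiv.ofInjective F hF.injective
  let G : polyAlgebra K A →ₐ[ℂ] S := e.symm.toAlgHom.comp (Subalgebra.inclusion hrange)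
  have hFG : ∀ f, F (G f) = f := fun f =>
    congrArg Subtype.val (e.apply_symm_apply (Subalgebra.inclusion hrange f))
  have hG : Isometry G := fun f g => by
    rw [← hF.edist_eq, hFG, hFG]
    rfl
  refine ⟨characterOfAlgHom (((AlgHom.snd ℂ C(K, A) ℂ).comp S.val).comp G)
    (continuous_snd.comp (continuous_subtype_val.comp hG.continuous)), fun P hP f hf => ?_⟩
  have : G f = ⟨_, hmem P hP f hf⟩ := hF.injective (hFG f)
  exact congrArg (fun p : S => p.1.2) this

/-- A continuous injection from a compact space into a Hausdorff space is a closed embedding.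
Constants recover `φ`, and the operators `x ↦ l(x) · 1` recover every `l(a)`, hence `a`. -/
theorem isClosedEmbedding_of_eval {K : TopologicalSpace.Compacts E}
    {j : nuclearHull K × WeakDual.characterSpace ℂ A →
      WeakDual.characterSpace ℂ (polyAlgebra K A)}
    (hc : ∀ p c, j p (polyConst K c) = p.2 c) (hT : ∀ p T, j p (polyOp K T) = p.2 (T p.1)) :
    Topology.IsClosedEmbedding j := by
  have : CompactSpace (nuclearHull K) :=
    isCompact_iff_compactSpace.1 (isCompact_nuclearHull K)
  refine (continuous_of_eval hc hT).isClosedEmbedding fun p q hpq => Prod.ext ?_ ?_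
  · refine Subtype.ext ((SeparatingDual.eq_iff_forall_dual_eq (R := ℂ)).2 fun l => ?_)
    have h := hT p (l.smulRight 1)
    rw [hpq, hT] at h
    simpa using h.symm
  · refine WeakDual.CharacterSpace.ext fun c => ?_
    rw [← hc, ← hc, hpq]

end Extension

end GenPoly
namespace GenPoly

/-! ### The injective tensor product as a closed subspace of `C(K, F)` -/

section TensorRange

variable {E : Type u} [NormedAddCommGroup E] [NormedSpace ℂ E]

/-- The restriction to `K` of a bounded linear operator with values in a normed space. -/
def restrOp (K : TopologicalSpace.Compacts E) {F : Type*} [NormedAddCommGroup F] [NormedSpace ℂ F]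
    (T : E →L[ℂ] F) : C(K, F) :=
  ⟨fun x => T x, T.continuous.comp continuous_subtype_val⟩

variable (K : TopologicalSpace.Compacts E)
variable (F : Type*) [NormedAddCommGroup F] [NormedSpace ℂ F] [CompleteSpace F]

/-- The space `𝒫_N(K) ⊗̂_ε F` as a subspace of `C(K, F)`. -/
def tensorRange : Submodule ℂ C(K, F) :=
  LinearMap.range (tensorToFun K F : CompletedInjTensor (nuclearAlgebra K) F →ₗ[ℂ] C(K, F))

variable {K F}

theorem isClosed_tensorRange : IsClosed (tensorRange K F : Set C(K, F)) :=
  (tensorToFun_isometry K F).isClosedEmbedding.isClosed_range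

theorem tmul_mem_tensorRange (f : nuclearAlgebra K) (y : F) :
    tensorToFunAlg K F (f ⊗ₜ y) ∈ tensorRange K F :=
  ⟨_, tensorToFun_coe K F (f ⊗ₜ[ℂ] y)⟩

theorem tensorRange_le {W : Submodule ℂ C(K, F)} (hW : IsClosed (W : Set C(K, F)))
    (h : ∀ (f : nuclearAlgebra K) (y : F), tensorToFunAlg K F (f ⊗ₜ y) ∈ W) :
    tensorRange K F ≤ W := by
  rintro _ ⟨u, rfl⟩
  change tensorToFun K F u ∈ W
  induction u using UniformSpace.Completion.induction_on with
  | hp => exact hW.preimage (tensorToFun K F).continuous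
  | ih t =>
    rw [tensorToFun_coe]
    refine TensorProduct.induction_on (motive := fun t => tensorToFunAlg K F t ∈ W) t ?_ h ?_
    · rw [map_zero]
      exact W.zero_mem
    · intro s t hs ht
      rw [map_add]
      exact W.add_mem hs ht

theorem comp_mem_tensorRange {G : Type*} [NormedAddCommGroup G] [NormedSpace ℂ G]
    [CompleteSpace G] (v : F →L[ℂ] G) {f : C(K, F)} (hf : f ∈ tensorRange K F) :
    v.compLeftContinuous ℂ K f ∈ tensorRange K G := by
  refine tensorRange_le (W := (tensorRange K G).comap
    (v.compLeftContinuous ℂ K : C(K, F) →ₗ[ℂ] C(K, G)))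
    (isClosed_tensorRange.preimage (v.compLeftContinuous ℂ K).continuous) (fun g y => ?_) hf
  have : v.compLeftContinuous ℂ K (tensorToFunAlg K F (g ⊗ₜ y)) =
      tensorToFunAlg K G (g ⊗ₜ v y) := by
    ext x
    exact map_smul v _ _
  change v.compLeftContinuous ℂ K _ ∈ tensorRange K G
  rw [this]
  exact tmul_mem_tensorRange g (v y)

/-- Expanding `u` in a basis of its range gives `u = ∑ lᵢ ⊗ bᵢ` with bounded functionals `lᵢ`, which
are nuclear polynomials. -/
theorem restrOp_mem_tensorRange_of_finiteDimensional (u : E →L[ℂ] F)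
    [FiniteDimensional ℂ (LinearMap.range (u : E →ₗ[ℂ] F))] : restrOp K u ∈ tensorRange K F := by
  let R := LinearMap.range (u : E →ₗ[ℂ] F)
  let b := Module.finBasis ℂ R
  let u' : E →L[ℂ] R := u.codRestrict R fun x => ⟨x, rfl⟩
  let l : Fin (Module.finrank ℂ R) → E →L[ℂ] ℂ := fun i =>
    (LinearMap.toContinuousLinearMap (b.coord i)).comp u'
  have h : restrOp K u = ∑ i, tensorToFunAlg K F (polyOp K (l i) ⊗ₜ (b i : F)) := by
    ext x
    rw [ContinuousMap.sum_apply]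
    exact ((congrArg R.subtype (b.sum_repr (u' x))).symm).trans (map_sum R.subtype _ _)
  rw [h]
  exact Submodule.sum_mem _ fun i _ => tmul_mem_tensorRange _ _

theorem restrOp_mem_of_approximable {u : E →L[ℂ] F}
    (h : ∀ ε > (0 : ℝ), ∃ v : E →L[ℂ] F,
      FiniteDimensional ℂ (LinearMap.range (v : E →ₗ[ℂ] F)) ∧ ∀ x ∈ K, ‖v x - u x‖ < ε) :
    restrOp K u ∈ tensorRange K F := by
  refine isClosed_tensorRange.closure_subset (Metric.mem_closure_iff.2 fun ε hε => ?_)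
  obtain ⟨v, hv, hvu⟩ := h (ε / 2) (half_pos hε)
  refine ⟨_, restrOp_mem_tensorRange_of_finiteDimensional v, lt_of_le_of_lt ?_ (half_lt_self hε)⟩
  rw [dist_comm, dist_eq_norm, ContinuousMap.norm_le _ (half_pos hε).le]
  exact fun x => (hvu x x.2).le

end TensorRange

/-! ### Comparison of `ℙ(K, A)` with the tensor product, and surjectivity -/

section TensorAlgebra

variable {E : Type u} [NormedAddCommGroup E] [NormedSpace ℂ E]
variable {K : TopologicalSpace.Compacts E}
variable {A : Type v} [NormedCommRing A] [NormedAlgebra ℂ A] [CompleteSpace A]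

theorem mul_mem_tensorRange {f g : C(K, A)} (hf : f ∈ tensorRange K A)
    (hg : g ∈ tensorRange K A) : f * g ∈ tensorRange K A := by
  refine tensorRange_le (W := (tensorRange K A).comap (LinearMap.mulRight ℂ g))
    (isClosed_tensorRange.preimage (continuous_mul_const g)) (fun p y => ?_) hf
  refine tensorRange_le
    (W := (tensorRange K A).comap (LinearMap.mulLeft ℂ (tensorToFunAlg K A (p ⊗ₜ y))))
    (isClosed_tensorRange.preimage (continuous_const_mul _)) (fun q z => ?_) hg
  have : tensorToFunAlg K A (p ⊗ₜ y) * tensorToFunAlg K A (q ⊗ₜ z) =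
      tensorToFunAlg K A ((p * q) ⊗ₜ (y * z)) := by
    ext x
    exact smul_mul_smul_comm _ _ _ _
  change tensorToFunAlg K A (p ⊗ₜ y) * tensorToFunAlg K A (q ⊗ₜ z) ∈ tensorRange K A
  rw [this]
  exact tmul_mem_tensorRange _ _

theorem const_mem_tensorRange (c : A) : ContinuousMap.const K c ∈ tensorRange K A := by
  have : ContinuousMap.const K c = tensorToFunAlg K A ((1 : nuclearAlgebra K) ⊗ₜ c) := by
    ext x
    exact (one_smul ℂ c).symm
  rw [this]
  exact tmul_mem_tensorRange _ _

variable (K A) in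
/-- The embedding of `𝒫_N(K)` into `ℙ(K, A)`, `f ↦ f · 1`. -/
def scalarEmb : nuclearAlgebra K →ₐ[ℂ] polyAlgebra K A :=
  (((Algebra.ofId ℂ A).compLeftContinuous ℂ (continuous_algebraMap ℂ A)).comp
    (nuclearAlgebra K).val).codRestrict _ fun f => by
      have hcont : Continuous ((Algebra.ofId ℂ A).compLeftContinuous ℂ
          (continuous_algebraMap ℂ A) : C(K, ℂ) → C(K, A)) :=
        ContinuousMap.continuous_postcomp ⟨algebraMap ℂ A, continuous_algebraMap ℂ A⟩
      refine polyAlgebra_le (S := (polyAlgebra K A).comap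
        ((Algebra.ofId ℂ A).compLeftContinuous ℂ (continuous_algebraMap ℂ A)))
        ((isClosed_polyAlgebra K).preimage hcont)
        (fun c => (polyConst K (algebraMap ℂ A c)).2) (fun l => ?_) f.2
      exact (polyOp K ((Algebra.linearMap ℂ A).toContinuousLinearMap.comp l)).2

theorem continuous_scalarEmb : Continuous (scalarEmb K A) :=
  ((ContinuousMap.continuous_postcomp
    (⟨algebraMap ℂ A, continuous_algebraMap ℂ A⟩ : C(ℂ, A))).comp
    continuous_subtype_val).subtype_mk _

theorem tensorToFunAlg_tmul_eq (f : nuclearAlgebra K) (c : A) :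
    tensorToFunAlg K A (f ⊗ₜ c) = (scalarEmb K A f * polyConst K c : polyAlgebra K A) := by
  ext x
  exact Algebra.smul_def _ _

theorem tensorRange_le_polyAlgebra :
    tensorRange K A ≤ Subalgebra.toSubmodule (polyAlgebra K A) :=
  tensorRange_le (isClosed_polyAlgebra K) fun f c => by
    rw [tensorToFunAlg_tmul_eq]
    exact (scalarEmb K A f * polyConst K c).2

/-- The tensor product is a closed subalgebra containing the constants, so by `polyAlgebra_le` only
the operators remain to be checked. -/
theorem polyEqTensor_of_restrOp_mem (h : ∀ T : E →L[ℂ] A, restrOp K T ∈ tensorRange K A) :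
    PolyEqTensor K A := by
  refine Set.Subset.antisymm (fun f hf => tensorRange_le_polyAlgebra hf) fun f hf => ?_
  exact polyAlgebra_le (S := (tensorRange K A).toSubalgebra (const_mem_tensorRange 1)
    fun f g => mul_mem_tensorRange) isClosed_tensorRange const_mem_tensorRange h hf

theorem HasApproximationProperty.polyEqTensor (h : HasApproximationProperty A) :
    PolyEqTensor K A := by
  refine polyEqTensor_of_restrOp_mem fun T => restrOp_mem_of_approximable fun ε hε => ?_
  -- Approximating the identity of `A` on the compact set `T(K)` makes `S ∘ T` a finite rank
  -- approximation of `T` on `K`.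
  obtain ⟨S, hS, hST⟩ := h ε hε _ (K.isCompact.image T.continuous)
  refine ⟨S.comp T, ?_, fun x hx => hST _ ⟨x, hx, rfl⟩⟩
  exact Submodule.finiteDimensional_of_le (LinearMap.range_comp_le_range (T : E →ₗ[ℂ] A) _)

variable [CompleteSpace E]

theorem PolyEqTensor.of_idMemTensor (h : IdMemTensor K) : PolyEqTensor K A :=
  polyEqTensor_of_restrOp_mem fun T => comp_mem_tensorRange T h

/-- The isomorphism `e` is itself an operator `E → B`, so `e|_K` lies in the tensor product with
`B`; composing with `e⁻¹` brings it back to the identity. -/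
theorem PolyEqTensor.idMemTensor {B : Type*} [NormedCommRing B] [NormedAlgebra ℂ B]
    [CompleteSpace B] (e : E ≃L[ℂ] B) (h : PolyEqTensor K B) : IdMemTensor K := by
  have h1 : restrCLM K (e : E →L[ℂ] B) ∈ tensorRange K B :=
    h.symm.subset (polyOp K (e : E →L[ℂ] B)).2
  have h2 := comp_mem_tensorRange (e.symm : B →L[ℂ] E) h1
  have h3 : (e.symm : B →L[ℂ] E).compLeftContinuous ℂ K (restrCLM K (e : E →L[ℂ] B)) =
      restrOp K (ContinuousLinearMap.id ℂ E) := by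
    ext x
    exact e.symm_apply_apply _
  rw [h3] at h2
  exact h2

theorem HasApproximationProperty.idMemTensor (h : HasApproximationProperty E) :
    IdMemTensor K :=
  restrOp_mem_of_approximable (u := ContinuousLinearMap.id ℂ E) fun ε hε => h ε hε K K.isCompact

theorem PolyEqTensor.surjective {j : nuclearHull K × WeakDual.characterSpace ℂ A →
      WeakDual.characterSpace ℂ (polyAlgebra K A)} (h : PolyEqTensor K A)
    (hc : ∀ p c, j p (polyConst K c) = p.2 c) (hT : ∀ p T, j p (polyOp K T) = p.2 (T p.1)) :
    Function.Surjective j := by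
  intro χ
  let χ' := WeakDual.CharacterSpace.toAlgHom χ
  let ι : A →ₐ[ℂ] polyAlgebra K A :=
    { toFun := polyConst K
      map_one' := rfl
      map_mul' := fun _ _ => rfl
      map_zero' := rfl
      map_add' := fun _ _ => rfl
      commutes' := fun _ => rfl }
  have hι : Continuous ι := ContinuousMap.continuous_const'.subtype_mk _
  -- The preimage of `χ`: its restriction to the constants gives `φ`, its restriction to the scalar
  -- functions `f · 1` gives the point `a`.
  let φ := characterOfAlgHom (χ'.comp ι) ((map_continuous χ).comp hι)
  obtain ⟨a, ha, hχa⟩ := exists_mem_nuclearHull (χ'.comp (scalarEmb K A))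
    ((map_continuous χ).comp continuous_scalarEmb)
  let p : nuclearHull K × WeakDual.characterSpace ℂ A := (⟨a, ha⟩, φ)
  have hscalar : (WeakDual.CharacterSpace.toAlgHom (j p)).comp (scalarEmb K A) =
      χ'.comp (scalarEmb K A) := by
    refine polyAlgebra_algHom_ext ((map_continuous (j p)).comp continuous_scalarEmb)
      ((map_continuous χ).comp continuous_scalarEmb) (fun c => ?_) fun l => ?_
    · exact ((AlgHom.commutes _ c).trans (AlgHom.commutes _ c).symm)
    · rw [hχa]
      have h1 := hT p ((Algebra.linearMap ℂ A).toContinuousLinearMap.comp l)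
      exact h1.trans (AlgHomClass.commutes φ (l a))
  have htop : ∀ f : polyAlgebra K A, j p f = χ f := by
    let W : Submodule ℂ (polyAlgebra K A) :=
      LinearMap.eqLocus (WeakDual.CharacterSpace.toCLM (j p) : polyAlgebra K A →ₗ[ℂ] ℂ)
        (WeakDual.CharacterSpace.toCLM χ : polyAlgebra K A →ₗ[ℂ] ℂ)
    have hW : IsClosed (W : Set (polyAlgebra K A)) :=
      isClosed_eq (map_continuous (j p)) (map_continuous χ)
    -- `χ` and `j p` agree on the products `f · c`, whose closed span is all of `ℙ(K, A)` by
    -- hypothesis.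
    have hle : tensorRange K A ≤ W.map (polyAlgebra K A).val.toLinearMap := by
      refine tensorRange_le ?_ fun f c => ⟨scalarEmb K A f * polyConst K c, ?_,
        (tensorToFunAlg_tmul_eq f c).symm⟩
      · rw [Submodule.map_coe]
        exact (isClosed_polyAlgebra K).isClosedEmbedding_subtypeVal.isClosedMap _ hW
      · change j p (_ * _) = χ (_ * _)
        rw [map_mul, map_mul, hc]
        congr 1
        exact DFunLike.congr_fun hscalar f
    intro f
    obtain ⟨g, hg, hgf⟩ := hle (h.symm.subset f.2)
    have : g = f := Subtype.ext hgf
    exact this ▸ hg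
  exact ⟨p, WeakDual.CharacterSpace.ext htop⟩

end TensorAlgebra

end GenPoly

end

/-! ### The main theorem -/

theorem mainTheorem4 {E : Type u} [NormedAddCommGroup E] [NormedSpace ℂ E] [CompleteSpace E]
    {A : Type v} [NormedCommRing A] [NormedAlgebra ℂ A] [CompleteSpace A]
    (K : TopologicalSpace.Compacts E) :
    ∃ j : GenPoly.nuclearHull K × WeakDual.characterSpace ℂ A →
        WeakDual.characterSpace ℂ (GenPoly.polyAlgebra K A),
      -- `j (a, φ)` is the character `P|_K ↦ φ (P a)`
      (∀ (a : GenPoly.nuclearHull K) (φ : WeakDual.characterSpace ℂ A),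
        ∀ P ∈ GenPoly.polySpace E A, ∀ f : GenPoly.polyAlgebra K A,
          (∀ x : K, (f : C(K, A)) x = P x) → j (a, φ) f = φ (P a)) ∧
      Topology.IsClosedEmbedding j ∧
      (GenPoly.PolyEqTensor K A → IsHomeomorph j) ∧
      -- `ℙ(K, E) = 𝒫_N(K) ⊗̂_ε E` for some Banach algebra structure on `E`
      (∀ (B : Type u) [NormedCommRing B] [NormedAlgebra ℂ B] [CompleteSpace B],
        Nonempty (E ≃L[ℂ] B) → GenPoly.PolyEqTensor K B →
          GenPoly.PolyEqTensor K A ∧ IsHomeomorph j) ∧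
      (GenPoly.IdMemTensor K → GenPoly.PolyEqTensor K A ∧ IsHomeomorph j) ∧
      (GenPoly.HasApproximationProperty E → GenPoly.PolyEqTensor K A ∧ IsHomeomorph j) ∧
      (GenPoly.HasApproximationProperty A → GenPoly.CharactersGenerate A →
        GenPoly.PolyEqTensor K A ∧ IsHomeomorph j) := by
  choose j hj using fun p : GenPoly.nuclearHull K × WeakDual.characterSpace ℂ A =>
    GenPoly.exists_character K p.1.2 p.2
  have hc : ∀ p c, j p (GenPoly.polyConst K c) = p.2 c := fun p c =>
    hj p _ (GenPoly.const_mem_polySpace c) _ fun _ => rfl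
  have hT : ∀ p T, j p (GenPoly.polyOp K T) = p.2 (T p.1) := fun p T =>
    hj p _ (GenPoly.clm_mem_polySpace T) _ fun _ => rfl
  have hcl : Topology.IsClosedEmbedding j := GenPoly.isClosedEmbedding_of_eval hc hT
  have hhom : GenPoly.PolyEqTensor K A → IsHomeomorph j := fun h =>
    isHomeomorph_iff_isEmbedding_surjective.2 ⟨hcl.isEmbedding, h.surjective hc hT⟩
  have hboth : GenPoly.PolyEqTensor K A → GenPoly.PolyEqTensor K A ∧ IsHomeomorph j :=
    fun h => ⟨h, hhom h⟩
  exact ⟨j, fun a φ => hj (a, φ), hcl, hhom,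
    fun B _ _ _ ⟨e⟩ h => hboth (GenPoly.PolyEqTensor.of_idMemTensor (h.idMemTensor e)),
    fun h => hboth (GenPoly.PolyEqTensor.of_idMemTensor h),
    fun h => hboth (GenPoly.PolyEqTensor.of_idMemTensor h.idMemTensor),
    fun h _ => hboth h.polyEqTensor⟩
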